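/- Let $p_1,p_2,p_3$ be three distinct points of the Riemann sphere $S^2$, let $\mathfrak{D}=p_1+p_2+p_3$ and let $K$ be the canonical bundle of $S^2$. A strongly parabolic Higgs bundle $(W,\Phi)$ (with trivial flags and zero weights) consists of a holomorphic vector bundle $W\to S^2$ and a Higgs field $\Phi\in H^0(K\,\mathfrak{sl}(W)\,\mathcal{O}(\mathfrak{D}))$, that is, a trace-free meromorphic $\mathrm{End}(W)$-valued $1$-form with at most simple poles along $\mathfrak{D}$, whose residues $\mathrm{Res}_{p_k}\Phi$ are nilpotent. If $\deg W=0$, it is stable if every $\Phi$-invariant holomorphic subbundle $0\neq E\subsetneq W$ has $\deg E<0$. Two Higgs bundles are isomorphic if a holomorphic bundle isomorphism intertwines their Higgs fields. The spaces $H^0(K\mathcal{O}(-1)\mathcal{O}(\mathfrak{D}))$ and $H^0(K^3\mathcal{O}(2\mathfrak{D}))$ are one-dimensional. Fix a nonzero section $\mathbf{1}\in H^0(K\mathcal{O}(-1)\mathcal{O}(\mathfrak{D}))$, viewed as a meromorphic $1$-form with values in $\mathcal{O}(-1)$ with at most simple poles along $\mathfrak{D}$. Let $(W,\Phi)$ be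 a stable strongly parabolic Higgs bundle of rank $3$ with $W\cong\mathcal{O}(-1)\oplus\mathcal{O}\oplus\mathcal{O}(1)$. Then there is a unique meromorphic cubic differential $Q\in H^0(K^3\mathcal{O}(2\mathfrak{D}))\cong\mathbb{C}$ (with at most double poles along $\mathfrak{D}$) such that $(W,\Phi)$ is isomorphic to $\mathcal{O}(-1)\oplus\mathcal{O}\oplus\mathcal{O}(1)$ with the Higgs field $$\Phi^Q=\begin{pmatrix}0&\mathbf{1}&0\\0&0&\mathbf{1}\\Q&0&0\end{pmatrix},$$ where the entry $Q$ stands for the $1$-form $q$ with values in $\mathcal{O}(2)$ that satisfies $q\,\mathbf{1}^2=Q$ (so that $Q=\det\Phi^Q$). At the punctures $\mathrm{Res}_{p_k}\mathbf{1}\neq0$ and $$\mathrm{Res}_{p_k}\Phi^Q=\begin{pmatrix}0&\mathrm{Res}_{p_k}\mathbf{1}&0\\0&0&\mathrm{Res}_{p_k}\mathbf{1}\\0&0&0\end{pmatrix}.$$ -/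

import Mathlib

open scoped Matrix

noncomputable section

namespace Sphere

/-! ### The Riemann sphere and its two charts

The Riemann sphere is `OnePoint ℂ`. Chart `0` has the coordinate `z` and misses `∞`, chart `1` has
the coordinate `w = 1 / z` and misses `0`. Holomorphic objects on the sphere are given by their
local expressions in the two charts, with a compatibility condition for `z ≠ 0`. -/

/-- The point of the sphere that has the coordinate `x` in chart `i`. -/
def point (i : Fin 2) (x : ℂ) : OnePoint ℂ :=
  if i = 0 then (x : OnePoint ℂ) else if x = 0 then OnePoint.infty else ((x⁻¹ : ℂ) : OnePoint ℂ)

/-! ### Line bundles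

A line bundle trivialised over both charts is given by its transition function `c`: the local
expressions `s 0`, `s 1` of a section satisfy `s 0 z = c z * s 1 (1 / z)` for `z ≠ 0`.
The product of transition functions is the transition function of the tensor product. -/

/-- The line bundle `𝒪(n)`. -/
def O (n : ℤ) : ℂ → ℂ := fun z => z ^ n

/-- The canonical bundle, trivialised by `dz` and `dw`; here `dw = - z⁻² dz`. -/
def K : ℂ → ℂ := fun z => -(z ^ 2)⁻¹

/-- The space of global holomorphic sections of a line bundle. -/
def H0 (c : ℂ → ℂ) : Submodule ℂ (Fin 2 → ℂ → ℂ) where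
  carrier := {s | (∀ i, Differentiable ℂ (s i)) ∧ ∀ z : ℂ, z ≠ 0 → s 0 z = c z * s 1 z⁻¹}
  add_mem' := by
    rintro s t ⟨hs, hs'⟩ ⟨ht, ht'⟩
    refine ⟨fun i => (hs i).add (ht i), fun z hz => ?_⟩
    simp only [Pi.add_apply, hs' z hz, ht' z hz]
    ring
  zero_mem' := ⟨fun _ => differentiable_const 0, fun z _ => by simp⟩
  smul_mem' := by
    rintro a s ⟨hs, hs'⟩
    refine ⟨fun i => (hs i).const_smul a, fun z hz => ?_⟩
    simp only [Pi.smul_apply, smul_eq_mul, hs' z hz]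
    ring

/-! ### Reduced effective divisors

A divisor `p₁ + ⋯ + pₙ` of distinct points is a finite set `D` of points. -/

/-- A local equation of the point `p` in chart `i`. -/
def pointEq (p : OnePoint ℂ) (i : Fin 2) (x : ℂ) : ℂ :=
  p.elim (if i = 0 then 1 else x) fun a => if i = 0 then x - a else 1 - a * x

/-- A local equation of the divisor `D` in chart `i`. -/
def divisorEq (D : Finset (OnePoint ℂ)) (i : Fin 2) (x : ℂ) : ℂ := ∏ p ∈ D, pointEq p i x

/-- The line bundle `𝒪(D)`. It is trivialised over chart `i` by the meromorphic function
`1 / divisorEq D i`, so that a section of `L ⊗ 𝒪(m D)` with local expressions `s i` is the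
meromorphic section of `L` with local expressions `s i / divisorEq D i ^ m`. The transition
function is the quotient of the local equations, see `divisorEq_eq`. -/
def OD (D : Finset (OnePoint ℂ)) : ℂ → ℂ := fun z => z ^ D.card

theorem pointEq_eq (p : OnePoint ℂ) {z : ℂ} (hz : z ≠ 0) :
    pointEq p 0 z = z * pointEq p 1 z⁻¹ := by
  cases p using OnePoint.rec with
  | infty => simp [pointEq, hz]
  | coe a => simp [pointEq]; field_simp

theorem divisorEq_eq (D : Finset (OnePoint ℂ)) {z : ℂ} (hz : z ≠ 0) :
    divisorEq D 0 z = OD D z * divisorEq D 1 z⁻¹ := by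
  simp only [divisorEq, OD, pointEq_eq _ hz, Finset.prod_mul_distrib, Finset.prod_const]

theorem pointEq_eq_zero_iff (p : OnePoint ℂ) (i : Fin 2) (x : ℂ) :
    pointEq p i x = 0 ↔ point i x = p := by
  cases p using OnePoint.rec with
  | infty =>
    by_cases hi : i = 0
    · simp [pointEq, point, hi]
    · by_cases hx : x = 0 <;> simp [pointEq, point, hi, hx]
  | coe a =>
    have key : pointEq (a : OnePoint ℂ) i x = if i = 0 then x - a else 1 - a * x := rfl
    rw [key]
    by_cases hi : i = 0
    · simp [point, hi, sub_eq_zero]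
    · by_cases hx : x = 0
      · simp [point, hi, hx]
      · simp only [point, hi, hx, if_false, OnePoint.coe_eq_coe, sub_eq_zero]
        rw [eq_comm, ← eq_div_iff hx, one_div, eq_comm]

/-- The local equation vanishes exactly at the points of `D`. -/
theorem divisorEq_eq_zero_iff (D : Finset (OnePoint ℂ)) (i : Fin 2) (x : ℂ) :
    divisorEq D i x = 0 ↔ point i x ∈ D := by
  simp [divisorEq, Finset.prod_eq_zero_iff, pointEq_eq_zero_iff]

/-- The zeros of the local equation are simple. -/
theorem deriv_divisorEq_ne_zero (D : Finset (OnePoint ℂ)) (i : Fin 2) (x : ℂ)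
    (h : point i x ∈ D) : deriv (divisorEq D i) x ≠ 0 := by
  classical
  have hd : ∀ p : OnePoint ℂ, DifferentiableAt ℂ (pointEq p i) x := by
    intro p
    unfold pointEq
    cases p using OnePoint.rec <;> by_cases hi : i = 0 <;>
      simp only [OnePoint.elim_infty, OnePoint.elim_some, hi, if_true, if_false] <;> fun_prop
  have h1 : deriv (pointEq (point i x) i) x ≠ 0 := by
    by_cases hi : i = 0
    · have : pointEq (point i x) i = fun y => y - x := by
        funext y; simp [pointEq, point, hi]
      rw [this]; simp
    · by_cases hx : x = 0
      · have : pointEq (point i x) i = fun y => y := by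
          funext y; simp [pointEq, point, hi, hx]
        rw [this]; simp
      · have : pointEq (point i x) i = fun y => 1 - x⁻¹ * y := by
          funext y; simp [pointEq, point, hi, hx]
        rw [this]; simp [hx]
  have h0 : pointEq (point i x) i x = 0 := (pointEq_eq_zero_iff _ _ _).2 rfl
  have hsplit : divisorEq D i =
      pointEq (point i x) i * fun y => ∏ p ∈ D.erase (point i x), pointEq p i y := by
    funext y
    exact (Finset.mul_prod_erase D (fun p => pointEq p i y) h).symm
  have hprod : DifferentiableAt ℂ
      (fun y => ∏ p ∈ D.erase (point i x), pointEq p i y) x := by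
    exact DifferentiableAt.fun_finsetProd fun p _ => hd p
  rw [hsplit, deriv_mul (hd _) hprod, h0, zero_mul, add_zero]
  refine mul_ne_zero h1 (Finset.prod_ne_zero_iff.2 fun p hp hz => ?_)
  exact (Finset.mem_erase.1 hp).1 ((pointEq_eq_zero_iff p i x).1 hz).symm

/-- The residue, at the point `x` of chart `i`, of the meromorphic form
`(f / divisorEq D i) dx` with at most simple poles along `D`. -/
def residue {V : Type*} [AddCommGroup V] [Module ℂ V] (D : Finset (OnePoint ℂ)) (i : Fin 2)
    (f : ℂ → V) (x : ℂ) : V :=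
  (deriv (divisorEq D i) x)⁻¹ • f x

/-! ### Vector bundles -/

/-- A holomorphic vector bundle of rank `r`, trivialised over both charts. The local expressions
of a section satisfy `s 0 z = T z *ᵥ s 1 (1 / z)` for `z ≠ 0`. -/
structure VBundle (r : ℕ) where
  T : ℂ → Matrix (Fin r) (Fin r) ℂ
  holo : ∀ j k, DifferentiableOn ℂ (fun z => T z j k) {0}ᶜ
  det_ne_zero : ∀ z, z ≠ 0 → (T z).det ≠ 0

/-- The bundle `𝒪(d₁) ⊕ ⋯ ⊕ 𝒪(dᵣ)`. -/
def sumO {r : ℕ} (d : Fin r → ℤ) : VBundle r where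
  T := fun z => Matrix.diagonal fun j => O (d j) z
  holo := by
    intro j k z hz
    by_cases h : j = k
    · subst h
      simp only [Matrix.diagonal_apply_eq, O]
      exact (differentiableAt_zpow.2 (Or.inl hz)).differentiableWithinAt
    · simp only [Matrix.diagonal_apply_ne _ h]
      exact differentiableWithinAt_const 0
  det_ne_zero := by
    intro z hz
    simp [Matrix.det_diagonal, O, Finset.prod_ne_zero_iff, zpow_ne_zero _ hz]

/-- `V` has degree `d`, that is, its determinant line bundle is isomorphic to `𝒪(d)`: there is an
isomorphism from `𝒪(d)` to `det V`, given in chart `i` by the nowhere vanishing function `u i`. -/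
def VBundle.HasDegree {r : ℕ} (V : VBundle r) (d : ℤ) : Prop :=
  ∃ u : Fin 2 → ℂ → ℂ, (∀ i, Differentiable ℂ (u i)) ∧ (∀ i x, u i x ≠ 0) ∧
    ∀ z : ℂ, z ≠ 0 → u 0 z * O d z = (V.T z).det * u 1 z⁻¹

/-- A holomorphic homomorphism of vector bundles. -/
structure BundleHom {k r : ℕ} (E : VBundle k) (V : VBundle r) where
  loc : Fin 2 → ℂ → Matrix (Fin r) (Fin k) ℂ
  holo : ∀ i j l, Differentiable ℂ fun x => loc i x j l
  compat : ∀ z : ℂ, z ≠ 0 → loc 0 z * E.T z = V.T z * loc 1 z⁻¹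

/-- A homomorphism of bundles that is an embedding of `E` as a subbundle of `V`: it is injective on
every fibre. -/
def BundleHom.IsSubbundle {k r : ℕ} {E : VBundle k} {V : VBundle r} (f : BundleHom E V) : Prop :=
  ∀ i x, Function.Injective fun v => f.loc i x *ᵥ v

/-- A homomorphism of bundles of equal rank that is an isomorphism: it is invertible on every
fibre. -/
def BundleHom.IsIso {r : ℕ} {V V' : VBundle r} (f : BundleHom V V') : Prop :=
  ∀ i x, IsUnit (f.loc i x)

/-! ### Higgs bundles -/

/-- A Higgs field on `V`, that is, a holomorphic section of `K ⊗ sl(V) ⊗ 𝒪(D)`. It is the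
meromorphic form `(loc i / divisorEq D i) dx` in chart `i`. -/
structure HiggsField (D : Finset (OnePoint ℂ)) {r : ℕ} (V : VBundle r) where
  loc : Fin 2 → ℂ → Matrix (Fin r) (Fin r) ℂ
  holo : ∀ i j k, Differentiable ℂ fun x => loc i x j k
  trace_eq_zero : ∀ i x, (loc i x).trace = 0
  compat : ∀ z : ℂ, z ≠ 0 → loc 0 z * V.T z = (K * OD D) z • (V.T z * loc 1 z⁻¹)

variable {D : Finset (OnePoint ℂ)} {r : ℕ} {V V' : VBundle r}

/-- Strongly parabolic, for trivial flags and zero weights: all residues are nilpotent. -/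
def HiggsField.StronglyParabolic (Φ : HiggsField D V) : Prop :=
  ∀ i x, point i x ∈ D → IsNilpotent (residue D i (Φ.loc i) x)

/-- The image of `f` is invariant under the Higgs field. -/
def HiggsField.Invariant (Φ : HiggsField D V) {k : ℕ} {E : VBundle k} (f : BundleHom E V) : Prop :=
  ∀ i x v, ∃ u, Φ.loc i x *ᵥ (f.loc i x *ᵥ v) = f.loc i x *ᵥ u

/-- Stability for bundles of degree zero: every proper nonzero invariant holomorphic subbundle has
negative degree. -/
def HiggsField.Stable (Φ : HiggsField D V) : Prop :=
  V.HasDegree 0 ∧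
    ∀ (k : ℕ) (E : VBundle k) (f : BundleHom E V), 0 < k → k < r → f.IsSubbundle →
      Φ.Invariant f → ∀ d : ℤ, E.HasDegree d → d < 0

/-- Two Higgs bundles are isomorphic if a bundle isomorphism intertwines their Higgs fields. -/
def HiggsField.Isomorphic (Φ : HiggsField D V) (Φ' : HiggsField D V') : Prop :=
  ∃ g : BundleHom V V', g.IsIso ∧ ∀ i x, g.loc i x * Φ.loc i x = Φ'.loc i x * g.loc i x

/-- The Higgs field on `𝒪(-1) ⊕ 𝒪 ⊕ 𝒪(1)` with the cyclic matrix
`(0, e, 0; 0, 0, e; Q, 0, 0)`, where `e` is a section of `K ⊗ 𝒪(-1) ⊗ 𝒪(D)` and `Q` a section of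
`K³ ⊗ 𝒪(2D)`. The cubic differential `Q` stands for the `𝒪(2)`-valued form `q` with `q e² = Q`;
written with meromorphic expressions the last condition is
`(Φ₃₁ / δ) * (e / δ) ^ 2 = Q / δ ^ 2` for the local equation `δ` of `D`. -/
def HiggsField.IsCyclic (Φ : HiggsField D (sumO ![-1, 0, 1])) (e Q : Fin 2 → ℂ → ℂ) : Prop :=
  ∀ i x, ∃ q : ℂ, Φ.loc i x = !![0, e i x, 0; 0, 0, e i x; q, 0, 0] ∧
    q * e i x ^ 2 = divisorEq D i x * Q i x

end Sphere

end

noncomputable section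

namespace Sphere

/-! ### Sections of line bundles -/

/-! With three punctures, `K ⊗ 𝒪(D)` has degree 1, and everything is a degree count on the sphere.
On `𝒪(-1) ⊕ 𝒪 ⊕ 𝒪(1)` the entry `(j, k)` of the Higgs field is a section of degree `1 + d j - d k`:
the corner `(0, 2)` vanishes, and the entries `(0, 1)` and `(1, 2)` are constants. If one of the two
constants were zero, `𝒪 ⊕ 𝒪(1)` or `𝒪(1)` would be invariant of degree 1, against stability.

Nilpotency at three points kills `tr Φ²`, which has degree 2, and leaves `det Φ = δ Q` with `δ` the
equation of `D` and `Q` of degree 0. By Cayley–Hamilton `Φ³ = det Φ` (`pow_three_eq_det`). The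
projection to `𝒪(-1)` is then a cyclic covector: its images under the powers of `Φ`, scaled by
powers of `e`, are the rows of `cyclicFrame`, which is invertible because the two constants are
nonzero and which conjugates `Φ` to the companion form. Uniqueness holds because `det Φ` is an
isomorphism invariant that determines `Q`. -/

theorem H0_congr {c c' : ℂ → ℂ} (h : ∀ z, z ≠ 0 → c z = c' z) : H0 c = H0 c' := by
  ext s
  refine and_congr_right fun _ => forall₂_congr fun z hz => ?_
  rw [h z hz]

/-- Liouville: since `n ≤ 0`, the transition relation gives the entire function `s 0` a limit at
infinity, so it is constantly equal to that limit. -/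
theorem apply_zero_eq_of_mem_H0 {a : ℂ} {n : ℤ} (hn : n ≤ 0) {s : Fin 2 → ℂ → ℂ}
    (hs : s ∈ H0 fun z => a * z ^ n) (x : ℂ) :
    s 0 x = if n = 0 then a * s 1 0 else 0 := by
  refine (hs.1 0).apply_eq_of_tendsto_cocompact x ?_
  have hinv : Filter.Tendsto (fun z : ℂ => z⁻¹) (Filter.cocompact ℂ) (nhds 0) := by
    rw [← Metric.cobounded_eq_cocompact]
    exact Filter.tendsto_inv₀_cobounded
  have h1 : Filter.Tendsto (fun z : ℂ => s 1 z⁻¹) (Filter.cocompact ℂ) (nhds (s 1 0)) :=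
    ((hs.1 1).continuous.tendsto 0).comp hinv
  obtain ⟨m, rfl⟩ : ∃ m : ℕ, n = -(m : ℤ) := ⟨n.natAbs, by omega⟩
  have h2 : Filter.Tendsto (fun z : ℂ => a * (z⁻¹) ^ m * s 1 z⁻¹) (Filter.cocompact ℂ)
      (nhds (a * 0 ^ m * s 1 0)) := ((hinv.pow m).const_mul a).mul h1
  have h3 : a * 0 ^ m * s 1 0 = if -(m : ℤ) = 0 then a * s 1 0 else 0 := by
    by_cases hm : m = 0 <;> simp [hm]
  rw [h3] at h2
  refine h2.congr' ?_
  have h0 : ∀ᶠ z : ℂ in Filter.cocompact ℂ, z ≠ 0 :=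
    (isCompact_singleton (x := (0 : ℂ))).compl_mem_cocompact
  filter_upwards [h0] with z hz
  simp only [hs.2 z hz, zpow_neg, zpow_natCast, inv_pow]

/-- The symmetry `z ↔ 1 / z` of the sphere, which carries results about chart `0` over to chart `1`.
-/
theorem swap_mem_H0 {a : ℂ} (ha : a ≠ 0) {n : ℤ} {s : Fin 2 → ℂ → ℂ}
    (hs : s ∈ H0 fun z => a * z ^ n) : ![s 1, s 0] ∈ H0 fun z => a⁻¹ * z ^ n := by
  refine ⟨fun i => ?_, fun z hz => ?_⟩
  · fin_cases i
    · exact hs.1 1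
    · exact hs.1 0
  · have := hs.2 z⁻¹ (inv_ne_zero hz)
    have hzn : z ^ n ≠ 0 := zpow_ne_zero n hz
    simp only [Matrix.cons_val_zero, Matrix.cons_val_one, inv_inv, inv_zpow] at this ⊢
    rw [this]
    field_simp

/-- A line bundle of negative degree has no nonzero sections. -/
theorem eq_zero_of_mem_H0 {a : ℂ} (ha : a ≠ 0) {n : ℤ} (hn : n < 0) {s : Fin 2 → ℂ → ℂ}
    (hs : s ∈ H0 fun z => a * z ^ n) (i : Fin 2) (x : ℂ) : s i x = 0 := by
  fin_cases i
  · simpa [hn.ne] using apply_zero_eq_of_mem_H0 hn.le hs x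
  · simpa [hn.ne] using apply_zero_eq_of_mem_H0 hn.le (swap_mem_H0 ha hs) x

/-- The sections of a line bundle of degree zero are constant. -/
theorem eq_const_of_mem_H0 {a : ℂ} (ha : a ≠ 0) {s : Fin 2 → ℂ → ℂ}
    (hs : s ∈ H0 fun z => a * z ^ (0 : ℤ)) :
    ∃ b, (∀ x, s 0 x = b) ∧ ∀ x, s 1 x = a⁻¹ * b := by
  have h0 := apply_zero_eq_of_mem_H0 le_rfl hs
  have h1 := apply_zero_eq_of_mem_H0 le_rfl (swap_mem_H0 ha hs)
  refine ⟨s 0 0, fun x => ?_, fun x => ?_⟩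
  · rw [h0, h0 0]
  · simpa using h1 x

theorem finrank_H0 {a : ℂ} (ha : a ≠ 0) :
    Module.finrank ℂ (H0 fun z => a * z ^ (0 : ℤ)) = 1 := by
  let v : H0 fun z => a * z ^ (0 : ℤ) :=
    ⟨![fun _ => 1, fun _ => a⁻¹], fun i => by fin_cases i <;> simp, fun z _ => by simp [ha]⟩
  have hv : v ≠ 0 := fun h => by
    have := congrFun (congrFun (congrArg Subtype.val h) 0) 0
    simp [v] at this
  rw [finrank_eq_one_iff_of_nonzero' v hv]
  rintro ⟨s, hs⟩
  obtain ⟨b, h0, h1⟩ := eq_const_of_mem_H0 ha hs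
  refine ⟨b, Subtype.ext (funext fun i => funext fun x => ?_)⟩
  fin_cases i
  · simp [v, h0]
  · simp [v, h1, mul_comm]

/-! ### Division by the equation of a divisor -/

theorem exists_pointEq_eq (p : OnePoint ℂ) (i : Fin 2) :
    ∃ b c : ℂ, (b ≠ 0 ∨ c ≠ 0) ∧ ∀ x, pointEq p i x = b * x + c := by
  cases p using OnePoint.rec with
  | infty =>
    by_cases hi : i = 0
    · exact ⟨0, 1, by simp, fun x => by simp [pointEq, hi]⟩
    · exact ⟨1, 0, by simp, fun x => by simp [pointEq, hi]⟩
  | coe a =>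
    by_cases hi : i = 0
    · exact ⟨1, -a, by simp, fun x => by simp [pointEq, hi]; ring⟩
    · exact ⟨-a, 1, by simp, fun x => by simp [pointEq, hi]; ring⟩

/-- If `b = 0` the factor is a nonzero constant (the point lies outside the chart); otherwise the
quotient is a divided difference at the root, whose singularity is removable. -/
theorem exists_eq_affine_mul {f : ℂ → ℂ} (hf : Differentiable ℂ f) {b c : ℂ}
    (hbc : b ≠ 0 ∨ c ≠ 0) (h : ∀ x, b * x + c = 0 → f x = 0) :
    ∃ t : ℂ → ℂ, Differentiable ℂ t ∧ ∀ x, f x = (b * x + c) * t x := by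
  by_cases hb : b = 0
  · have hc : c ≠ 0 := by simpa [hb] using hbc
    exact ⟨fun x => c⁻¹ * f x, hf.const_mul _, fun x => by simp [hb, hc]⟩
  · have h0 : f (-c / b) = 0 := h _ (by field_simp; ring)
    refine ⟨fun x => b⁻¹ * dslope f (-c / b) x, ?_, fun x => ?_⟩
    · refine Differentiable.const_mul ?_ _
      rw [← differentiableOn_univ] at hf ⊢
      exact (Complex.differentiableOn_dslope Filter.univ_mem).2 hf
    · have := sub_smul_dslope f (-c / b) x
      rw [h0, sub_zero, smul_eq_mul] at this
      rw [← this]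
      field_simp
      ring

theorem exists_eq_pointEq_mul {a : ℂ} {n : ℤ} {s : Fin 2 → ℂ → ℂ}
    (hs : s ∈ H0 fun z => a * z ^ n) (p : OnePoint ℂ) (hp : ∀ i x, point i x = p → s i x = 0) :
    ∃ t ∈ H0 fun z => a * z ^ (n - 1), ∀ i x, s i x = pointEq p i x * t i x := by
  have key : ∀ i, ∃ t : ℂ → ℂ, Differentiable ℂ t ∧ ∀ x, s i x = pointEq p i x * t x := by
    intro i
    obtain ⟨b, c, hbc, h⟩ := exists_pointEq_eq p i
    simp only [h]
    refine exists_eq_affine_mul (hs.1 i) hbc fun x hx => hp i x ?_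
    rwa [← pointEq_eq_zero_iff, h]
  choose t ht hst using key
  refine ⟨t, ⟨ht, ?_⟩, hst⟩
  have off : ∀ z, z ≠ 0 → pointEq p 0 z ≠ 0 → t 0 z = a * z ^ (n - 1) * t 1 z⁻¹ := by
    intro z hz hpz
    have h := hs.2 z hz
    rw [hst, hst] at h
    refine mul_left_cancel₀ hpz ?_
    rw [h, zpow_sub_one₀ hz, pointEq_eq p hz]
    field_simp
  intro z₀ hz₀
  by_cases hpz : pointEq p 0 z₀ = 0
  swap
  · exact off z₀ hz₀ hpz
  -- At `p` itself the factor cannot be cancelled; the relation extends there because both sides are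
  -- continuous.
  have hr : ContinuousAt (fun z => a * z ^ (n - 1) * t 1 z⁻¹) z₀ := by
    refine (continuousAt_const.mul (continuousAt_zpow₀ z₀ _ (Or.inl hz₀))).mul ?_
    exact ContinuousAt.comp (g := t 1) (ht 1).continuous.continuousAt (continuousAt_inv₀ hz₀)
  refine tendsto_nhds_unique (f := t 0) (l := nhdsWithin z₀ {z₀}ᶜ)
    ((ht 0).continuous.continuousAt.tendsto.mono_left nhdsWithin_le_nhds) ?_
  refine (hr.tendsto.mono_left nhdsWithin_le_nhds).congr' ?_
  filter_upwards [self_mem_nhdsWithin, mem_nhdsWithin_of_mem_nhds (isOpen_ne.mem_nhds hz₀)]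
    with z hz hz'
  refine (off z hz' fun h => hz ?_).symm
  rw [pointEq_eq_zero_iff] at h hpz
  have : point 0 z = point 0 z₀ := h.trans hpz.symm
  simpa [point] using this

/-- A section that vanishes along a divisor is a multiple of the equation of the divisor. -/
theorem exists_eq_divisorEq_mul (D : Finset (OnePoint ℂ)) {a : ℂ} {n : ℤ} {s : Fin 2 → ℂ → ℂ}
    (hs : s ∈ H0 fun z => a * z ^ n) (hD : ∀ i x, point i x ∈ D → s i x = 0) :
    ∃ t ∈ H0 fun z => a * z ^ (n - D.card), ∀ i x, s i x = divisorEq D i x * t i x := by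
  classical
  induction D using Finset.induction_on with
  | empty => exact ⟨s, by simpa using hs, by simp [divisorEq]⟩
  | insert p D hp ih =>
    obtain ⟨t, ht, hst⟩ := ih fun i x hx => hD i x (Finset.mem_insert_of_mem hx)
    obtain ⟨u, hu, htu⟩ := exists_eq_pointEq_mul ht p fun i x hx => by
      have h := hD i x (by simp [hx])
      rw [hst] at h
      -- The points are distinct, so the equation of `D` does not vanish at `p` and the quotient `t`
      -- must.
      refine (mul_eq_zero.1 h).resolve_left fun h' => hp ?_
      rwa [divisorEq_eq_zero_iff, hx] at h'
    refine ⟨u, ?_, fun i x => ?_⟩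
    · have : n - ((insert p D).card : ℤ) = n - D.card - 1 := by
        rw [Finset.card_insert_of_notMem hp]; push_cast; ring
      rwa [this]
    · rw [hst, htu, divisorEq, divisorEq, Finset.prod_insert hp]; ring

theorem exists_divisorEq_ne_zero (D : Finset (OnePoint ℂ)) (i : Fin 2) :
    ∃ x, divisorEq D i x ≠ 0 := by
  by_contra! h
  have hinj : Function.Injective (point i) := by
    intro x y hxy
    by_cases hi : i = 0
    · simpa [point, hi] using hxy
    · by_cases hx : x = 0 <;> by_cases hy : y = 0 <;> simp_all [point]
  exact Set.infinite_univ ((D.finite_toSet.preimage hinj.injOn).subset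
    fun x _ => (divisorEq_eq_zero_iff D i x).1 (h x))

/-! ### Homomorphisms of bundles -/

theorem differentiable_matrix_mul {l m n : ℕ} {A : ℂ → Matrix (Fin l) (Fin m) ℂ}
    {B : ℂ → Matrix (Fin m) (Fin n) ℂ} (hA : ∀ i j, Differentiable ℂ fun x => A x i j)
    (hB : ∀ i j, Differentiable ℂ fun x => B x i j) (i : Fin l) (j : Fin n) :
    Differentiable ℂ fun x => (A x * B x) i j := by
  simp only [Matrix.mul_apply]
  exact Differentiable.fun_sum fun k _ => (hA i k).mul (hB k j)

theorem differentiable_matrix_det {n : ℕ} {A : ℂ → Matrix (Fin n) (Fin n) ℂ}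
    (hA : ∀ i j, Differentiable ℂ fun x => A x i j) : Differentiable ℂ fun x => (A x).det := by
  simp only [Matrix.det_apply]
  refine Differentiable.fun_sum fun σ _ => Differentiable.const_smul ?_ _
  exact Differentiable.fun_finsetProd fun k _ => hA _ _

theorem differentiable_matrix_inv {n : ℕ} {A : ℂ → Matrix (Fin n) (Fin n) ℂ}
    (hA : ∀ i j, Differentiable ℂ fun x => A x i j) (hu : ∀ x, IsUnit (A x)) (i j : Fin n) :
    Differentiable ℂ fun x => (A x)⁻¹ i j := by
  simp only [Matrix.inv_def, Matrix.smul_apply, Ring.inverse_eq_inv', smul_eq_mul,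
    Matrix.adjugate_apply]
  refine ((differentiable_matrix_det hA).inv fun x => ?_).mul (differentiable_matrix_det ?_)
  · exact ((Matrix.isUnit_iff_isUnit_det _).1 (hu x)).ne_zero
  · intro k l
    by_cases h : k = j
    · subst h
      simp
    · simpa [h] using hA k l

variable {D : Finset (OnePoint ℂ)} {k r : ℕ} {E : VBundle k} {V V' V'' : VBundle r}

/-- The composition of two homomorphisms of bundles. -/
def BundleHom.comp (g : BundleHom V V') (f : BundleHom E V) : BundleHom E V' where
  loc i x := g.loc i x * f.loc i x
  holo i := differentiable_matrix_mul (g.holo i) (f.holo i)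
  compat z hz := by
    rw [Matrix.mul_assoc, f.compat z hz, ← Matrix.mul_assoc, g.compat z hz, Matrix.mul_assoc]

theorem BundleHom.IsIso.comp {g : BundleHom V' V''} {f : BundleHom V V'} (hg : g.IsIso)
    (hf : f.IsIso) : (g.comp f).IsIso := fun i x => (hg i x).mul (hf i x)

theorem BundleHom.IsIso.isUnit_det {f : BundleHom V V'} (hf : f.IsIso) (i : Fin 2) (x : ℂ) :
    IsUnit (f.loc i x).det := (Matrix.isUnit_iff_isUnit_det _).1 (hf i x)

/-- The inverse of an isomorphism of bundles. -/
def BundleHom.IsIso.symm {f : BundleHom V V'} (hf : f.IsIso) : BundleHom V' V where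
  loc i x := (f.loc i x)⁻¹
  holo i := differentiable_matrix_inv (f.holo i) (hf i)
  compat z hz := by
    have h := f.compat z hz
    have h0 := Matrix.nonsing_inv_mul _ (hf.isUnit_det 0 z)
    have h1 := Matrix.mul_nonsing_inv _ (hf.isUnit_det 1 z⁻¹)
    calc (f.loc 0 z)⁻¹ * V'.T z
        = (f.loc 0 z)⁻¹ * (V'.T z * f.loc 1 z⁻¹) * (f.loc 1 z⁻¹)⁻¹ := by
          rw [Matrix.mul_assoc, Matrix.mul_assoc, h1, Matrix.mul_one]
      _ = V.T z * (f.loc 1 z⁻¹)⁻¹ := by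
          rw [← h, ← Matrix.mul_assoc, h0, Matrix.one_mul]

theorem BundleHom.IsIso.isIso_symm {f : BundleHom V V'} (hf : f.IsIso) : hf.symm.IsIso :=
  fun i x => (Matrix.isUnit_nonsing_inv_iff).2 (hf i x)

/-! ### Higgs fields -/

/-- The Higgs field on `V'` that corresponds to `Φ` under an isomorphism. -/
def HiggsField.conj (Φ : HiggsField D V) {f : BundleHom V V'} (hf : f.IsIso) :
    HiggsField D V' where
  loc i x := f.loc i x * Φ.loc i x * (f.loc i x)⁻¹
  holo i := differentiable_matrix_mul (differentiable_matrix_mul (f.holo i) (Φ.holo i))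
    (hf.symm.holo i)
  trace_eq_zero i x := by
    rw [Matrix.trace_mul_comm, ← Matrix.mul_assoc, Matrix.nonsing_inv_mul _ (hf.isUnit_det i x),
      Matrix.one_mul, Φ.trace_eq_zero]
  compat z hz := by
    have h : (f.loc 0 z)⁻¹ * V'.T z = V.T z * (f.loc 1 z⁻¹)⁻¹ := hf.symm.compat z hz
    rw [Matrix.mul_assoc, h, ← Matrix.mul_assoc, Matrix.mul_assoc (f.loc 0 z), Φ.compat z hz,
      Matrix.mul_smul, Matrix.smul_mul, ← Matrix.mul_assoc, f.compat z hz]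
    simp only [Matrix.mul_assoc]

theorem HiggsField.mul_eq_conj_mul (Φ : HiggsField D V) {f : BundleHom V V'} (hf : f.IsIso)
    (i : Fin 2) (x : ℂ) : f.loc i x * Φ.loc i x = (Φ.conj hf).loc i x * f.loc i x := by
  simp only [conj]
  rw [Matrix.mul_assoc _ _ (f.loc i x), Matrix.nonsing_inv_mul _ (hf.isUnit_det i x),
    Matrix.mul_one]

theorem HiggsField.Isomorphic.trans {Φ : HiggsField D V} {Φ' : HiggsField D V'}
    {Φ'' : HiggsField D V''} (h : Φ.Isomorphic Φ') (h' : Φ'.Isomorphic Φ'') :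
    Φ.Isomorphic Φ'' := by
  obtain ⟨f, hf, hfΦ⟩ := h
  obtain ⟨g, hg, hgΦ⟩ := h'
  refine ⟨g.comp f, hg.comp hf, fun i x => ?_⟩
  simp only [BundleHom.comp]
  rw [Matrix.mul_assoc, hfΦ, ← Matrix.mul_assoc, hgΦ, Matrix.mul_assoc]

theorem HiggsField.Isomorphic.det_eq {Φ : HiggsField D V} {Φ' : HiggsField D V'}
    (h : Φ.Isomorphic Φ') (i : Fin 2) (x : ℂ) : (Φ.loc i x).det = (Φ'.loc i x).det := by
  obtain ⟨f, hf, hfΦ⟩ := h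
  have := congrArg Matrix.det (hfΦ i x)
  rw [Matrix.det_mul, Matrix.det_mul, mul_comm] at this
  exact mul_right_cancel₀ (hf.isUnit_det i x).ne_zero this

/-- The zeros of the divisor equation are simple, so residue and local expression differ by a
nonzero scalar. -/
theorem HiggsField.StronglyParabolic.isNilpotent {Φ : HiggsField D V}
    (h : Φ.StronglyParabolic) (i : Fin 2) (x : ℂ) (hx : point i x ∈ D) :
    IsNilpotent (Φ.loc i x) := by
  have := (h i x hx).smul (deriv (divisorEq D i) x)
  rwa [residue, smul_smul, mul_inv_cancel₀ (deriv_divisorEq_ne_zero D i x hx), one_smul] at this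

theorem HiggsField.isNilpotent_conj (Φ : HiggsField D V) {f : BundleHom V V'} (hf : f.IsIso)
    {i : Fin 2} {x : ℂ} (h : IsNilpotent (Φ.loc i x)) : IsNilpotent ((Φ.conj hf).loc i x) := by
  obtain ⟨n, hn⟩ := h
  have key : ∀ m : ℕ, f.loc i x * Φ.loc i x ^ m = (Φ.conj hf).loc i x ^ m * f.loc i x := by
    intro m
    induction m with
    | zero => simp
    | succ m ih =>
      rw [pow_succ, ← Matrix.mul_assoc, ih, Matrix.mul_assoc, Φ.mul_eq_conj_mul hf,
        ← Matrix.mul_assoc, pow_succ]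
  refine ⟨n, ?_⟩
  have := key n
  rw [hn, Matrix.mul_zero] at this
  rw [← Matrix.mul_nonsing_inv_cancel_right (A := f.loc i x) ((Φ.conj hf).loc i x ^ n)
    (hf.isUnit_det i x), ← this, Matrix.zero_mul]

/-- Composing with the inverse of `f` turns an invariant subbundle of `V'` into one of `V`, so
destabilising subbundles can be sought in the explicit splitting. -/
theorem HiggsField.Stable.degree_neg_of_conj {Φ : HiggsField D V} (h : Φ.Stable)
    {f : BundleHom V V'} (hf : f.IsIso) (hk : 0 < k) (hkr : k < r) (s : BundleHom E V')
    (hs : s.IsSubbundle) (hinv : (Φ.conj hf).Invariant s) {d : ℤ} (hd : E.HasDegree d) :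
    d < 0 := by
  refine h.2 k E (hf.symm.comp s) hk hkr (fun i x v w hvw => ?_) (fun i x v => ?_) d hd
  · simp only [BundleHom.comp, ← Matrix.mulVec_mulVec] at hvw
    exact hs i x (Matrix.mulVec_injective_of_isUnit (hf.isIso_symm i x) hvw)
  · obtain ⟨u, hu⟩ := hinv i x v
    refine ⟨u, ?_⟩
    have hinv : (f.loc i x)⁻¹ * f.loc i x = 1 := Matrix.nonsing_inv_mul _ (hf.isUnit_det i x)
    simp only [BundleHom.comp, ← Matrix.mulVec_mulVec]
    rw [← hu]
    simp only [BundleHom.IsIso.symm, conj, Matrix.mulVec_mulVec]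
    simp only [← Matrix.mul_assoc, hinv, Matrix.one_mul]

/-- The degree is `-2 + 3 = 1`; the sign comes from `dw = -z⁻² dz`. -/
theorem K_mul_OD (hD : D.card = 3) {z : ℂ} (hz : z ≠ 0) : (K * OD D) z = -z := by
  simp only [K, OD, Pi.mul_apply, hD]
  field_simp

theorem HiggsField.det_mem_H0 (hD : D.card = 3) (Φ : HiggsField D V) :
    (fun i x => (Φ.loc i x).det) ∈ H0 fun z => (-1) ^ r * z ^ (r : ℤ) := by
  refine ⟨fun i => differentiable_matrix_det (Φ.holo i), fun z hz => ?_⟩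
  have h := congrArg Matrix.det (Φ.compat z hz)
  rw [K_mul_OD hD hz, Matrix.det_smul, Matrix.det_mul, Matrix.det_mul, Fintype.card_fin] at h
  refine mul_right_cancel₀ (V.det_ne_zero z hz) (h.trans ?_)
  simp only [neg_pow z r, zpow_natCast]
  ring

theorem HiggsField.trace_sq_mem_H0 (hD : D.card = 3) (Φ : HiggsField D V) :
    (fun i x => (Φ.loc i x * Φ.loc i x).trace) ∈ H0 fun z => 1 * z ^ (2 : ℤ) := by
  refine ⟨fun i => ?_, fun z hz => ?_⟩
  · simp only [Matrix.trace, Matrix.diag_apply]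
    exact Differentiable.fun_sum fun j _ => differentiable_matrix_mul (Φ.holo i) (Φ.holo i) j j
  · have hT : IsUnit (V.T z).det := (V.det_ne_zero z hz).isUnit
    have h := Φ.compat z hz
    rw [K_mul_OD hD hz] at h
    have h2 : Φ.loc 0 z * Φ.loc 0 z * V.T z
        = z ^ 2 • (V.T z * (Φ.loc 1 z⁻¹ * Φ.loc 1 z⁻¹)) := by
      rw [Matrix.mul_assoc, h, Matrix.mul_smul, ← Matrix.mul_assoc, h, Matrix.smul_mul, smul_smul,
        Matrix.mul_assoc]
      congr 1
      ring
    simp only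
    rw [← Matrix.mul_nonsing_inv_cancel_right (A := V.T z) (Φ.loc 0 z * Φ.loc 0 z) hT, h2,
      Matrix.smul_mul, Matrix.trace_smul, Matrix.trace_mul_comm,
      Matrix.nonsing_inv_mul_cancel_left (A := V.T z) _ hT, smul_eq_mul, one_mul]
    norm_cast

/-- The coefficients of the characteristic polynomial of a strongly parabolic Higgs field. -/
theorem HiggsField.trace_sq_eq_zero (hD : D.card = 3) (Φ : HiggsField D V)
    (hnil : ∀ i x, point i x ∈ D → IsNilpotent (Φ.loc i x)) (i : Fin 2) (x : ℂ) :
    (Φ.loc i x * Φ.loc i x).trace = 0 := by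
  obtain ⟨t, ht, h⟩ := exists_eq_divisorEq_mul D (Φ.trace_sq_mem_H0 hD) fun i x hx =>
    (Matrix.isNilpotent_trace_of_isNilpotent
      ((Commute.refl (Φ.loc i x)).isNilpotent_mul_right (hnil i x hx))).eq_zero
  -- The quotient by the equation of `D` has degree `2 - 3 < 0`.
  rw [h i x, eq_zero_of_mem_H0 one_ne_zero (by simp [hD]) ht, mul_zero]

theorem H0_cubic (hD : D.card = 3) : H0 (K ^ 3 * OD D ^ 2) = H0 fun z => -1 * z ^ (0 : ℤ) :=
  H0_congr fun z hz => by
    simp only [K, OD, Pi.mul_apply, Pi.pow_apply, hD]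
    field_simp

theorem H0_one (hD : D.card = 3) : H0 (K * O (-1) * OD D) = H0 fun z => -1 * z ^ (0 : ℤ) :=
  H0_congr fun z hz => by
    simp only [K, O, OD, Pi.mul_apply, hD, zpow_neg_one]
    field_simp

/-- A nilpotent matrix has determinant zero, so the determinant, of degree 3, is divisible by the
equation of `D`; this lowers its pole order from three to two. -/
theorem HiggsField.exists_det_eq (hD : D.card = 3) {V : VBundle 3} (Φ : HiggsField D V)
    (hnil : ∀ i x, point i x ∈ D → IsNilpotent (Φ.loc i x)) :
    ∃ Q ∈ H0 (K ^ 3 * OD D ^ 2), ∀ i x, (Φ.loc i x).det = divisorEq D i x * Q i x := by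
  obtain ⟨t, ht, h⟩ := exists_eq_divisorEq_mul D (Φ.det_mem_H0 hD) fun i x hx =>
    let ⟨n, hn⟩ := hnil i x hx
    pow_eq_zero_iff n.succ_ne_zero |>.1 <| by
      rw [← Matrix.det_pow, pow_succ, hn, zero_mul, Matrix.det_zero]
  refine ⟨t, ?_, h⟩
  rw [H0_cubic hD]
  convert ht using 3
  rw [hD]
  norm_num

/-! ### Higgs fields on `𝒪(-1) ⊕ 𝒪 ⊕ 𝒪(1)` -/

/-- The entry is a map `𝒪(d k) → 𝒪(d j)` twisted by a bundle of degree 1. -/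
theorem HiggsField.entry_mem_H0 (hD : D.card = 3) {r : ℕ} {d : Fin r → ℤ}
    (Φ : HiggsField D (sumO d)) (j k : Fin r) :
    (fun i x => Φ.loc i x j k) ∈ H0 fun z => -1 * z ^ (1 + d j - d k) := by
  refine ⟨fun i => Φ.holo i j k, fun z hz => ?_⟩
  have h := congrFun (congrFun (Φ.compat z hz) j) k
  rw [K_mul_OD hD hz] at h
  simp only [sumO, O, Matrix.mul_diagonal, Matrix.smul_apply, Matrix.diagonal_mul,
    smul_eq_mul] at h
  have hzk := zpow_ne_zero (d k) hz
  refine mul_right_cancel₀ hzk (h.trans ?_)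
  simp only [zpow_sub₀ hz, zpow_add₀ hz, zpow_one]
  field_simp

theorem hasDegree_sumO {r : ℕ} (d : Fin r → ℤ) : (sumO d).HasDegree (∑ j, d j) := by
  refine ⟨fun _ _ => 1, fun i => differentiable_const 1, fun i x => one_ne_zero, fun z hz => ?_⟩
  simp only [sumO, Matrix.det_diagonal, O, one_mul, mul_one]
  induction (Finset.univ : Finset (Fin r)) using Finset.induction_on with
  | empty => simp
  | insert j s hj ih => rw [Finset.sum_insert hj, Finset.prod_insert hj, zpow_add₀ hz, ih]

/-- The inclusion of `𝒪(1)` in `𝒪(-1) ⊕ 𝒪 ⊕ 𝒪(1)`. -/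
def lineIncl : BundleHom (sumO ![1]) (sumO ![-1, 0, 1]) where
  loc _ _ := !![0; 0; 1]
  holo i j l := differentiable_const _
  compat z hz := by
    ext j l
    fin_cases j <;> fin_cases l <;> simp [sumO, O, Matrix.mul_apply, Fin.sum_univ_succ]

/-- The inclusion of `𝒪 ⊕ 𝒪(1)` in `𝒪(-1) ⊕ 𝒪 ⊕ 𝒪(1)`. -/
def planeIncl : BundleHom (sumO ![0, 1]) (sumO ![-1, 0, 1]) where
  loc _ _ := !![0, 0; 1, 0; 0, 1]
  holo i j l := differentiable_const _
  compat z hz := by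
    ext j l
    fin_cases j <;> fin_cases l <;> simp [sumO, O, Matrix.mul_apply, Fin.sum_univ_succ]

theorem isSubbundle_lineIncl : lineIncl.IsSubbundle := by
  intro i x v w h
  have h2 := congrFun h 2
  simp [lineIncl, Matrix.mulVec, dotProduct] at h2
  ext j
  fin_cases j
  exact h2

theorem isSubbundle_planeIncl : planeIncl.IsSubbundle := by
  intro i x v w h
  have h1 := congrFun h 1
  have h2 := congrFun h 2
  simp [planeIncl, Matrix.mulVec, dotProduct, Fin.sum_univ_succ] at h1 h2
  ext j
  fin_cases j
  · exact h1
  · exact h2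

variable (Φ : HiggsField D (sumO ![-1, 0, 1]))

theorem HiggsField.loc_zero_two (hD : D.card = 3) (i : Fin 2) (x : ℂ) : Φ.loc i x 0 2 = 0 :=
  eq_zero_of_mem_H0 (by simp) (by simp) (Φ.entry_mem_H0 hD 0 2) i x

theorem invariant_lineIncl (hD : D.card = 3) (h : ∀ i x, Φ.loc i x 1 2 = 0) :
    Φ.Invariant lineIncl := by
  intro i x v
  refine ⟨fun _ => Φ.loc i x 2 2 * v 0, ?_⟩
  ext j
  fin_cases j <;>
    simp [lineIncl, Matrix.mulVec, dotProduct, Fin.sum_univ_succ, Φ.loc_zero_two hD, h]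

theorem invariant_planeIncl (hD : D.card = 3) (h : ∀ i x, Φ.loc i x 0 1 = 0) :
    Φ.Invariant planeIncl := by
  intro i x v
  refine ⟨![Φ.loc i x 1 1 * v 0 + Φ.loc i x 1 2 * v 1,
    Φ.loc i x 2 1 * v 0 + Φ.loc i x 2 2 * v 1], ?_⟩
  ext j
  fin_cases j <;>
    simp [planeIncl, Matrix.mulVec, dotProduct, Fin.sum_univ_succ, Φ.loc_zero_two hD, h]

theorem ne_zero_of_mem_H0 {s : Fin 2 → ℂ → ℂ} (hs : s ∈ H0 fun z => -1 * z ^ (0 : ℤ))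
    (h : s ≠ 0) (i : Fin 2) (x : ℂ) : s i x ≠ 0 := by
  obtain ⟨b, h0, h1⟩ := eq_const_of_mem_H0 (by simp) hs
  have hb : b ≠ 0 := by
    rintro rfl
    refine h (funext fun j => funext fun y => ?_)
    fin_cases j
    · exact h0 y
    · simpa using h1 y
  fin_cases i
  · simpa [h0] using hb
  · simpa [h1] using hb

theorem HiggsField.Stable.loc_zero_one_ne_zero (hD : D.card = 3) {W : VBundle 3}
    {Φ : HiggsField D W} (hst : Φ.Stable) {f : BundleHom W (sumO ![-1, 0, 1])} (hf : f.IsIso)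
    (i : Fin 2) (x : ℂ) : (Φ.conj hf).loc i x 0 1 ≠ 0 := by
  refine ne_zero_of_mem_H0 (by simpa using (Φ.conj hf).entry_mem_H0 hD 0 1) (fun h => ?_) i x
  have := hst.degree_neg_of_conj hf (by simp) (by simp) planeIncl isSubbundle_planeIncl
    (invariant_planeIncl _ hD fun i x => congrFun (congrFun h i) x) (hasDegree_sumO _)
  simp at this

theorem HiggsField.Stable.loc_one_two_ne_zero (hD : D.card = 3) {W : VBundle 3}
    {Φ : HiggsField D W} (hst : Φ.Stable) {f : BundleHom W (sumO ![-1, 0, 1])} (hf : f.IsIso)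
    (i : Fin 2) (x : ℂ) : (Φ.conj hf).loc i x 1 2 ≠ 0 := by
  refine ne_zero_of_mem_H0 (by simpa using (Φ.conj hf).entry_mem_H0 hD 1 2) (fun h => ?_) i x
  have := hst.degree_neg_of_conj hf (by simp) (by simp) lineIncl isSubbundle_lineIncl
    (invariant_lineIncl _ hD fun i x => congrFun (congrFun h i) x) (hasDegree_sumO _)
  simp at this

/-! ### The cyclic normal form -/

/-- Cayley–Hamilton: the coefficient of `A` in the characteristic polynomial is `((tr A)² - tr A²) /
2`, which vanishes along with the trace. -/
theorem pow_three_eq_det {A : Matrix (Fin 3) (Fin 3) ℂ} (h1 : A.trace = 0)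
    (h2 : (A * A).trace = 0) : A * A * A = A.det • (1 : Matrix (Fin 3) (Fin 3) ℂ) := by
  simp only [Matrix.trace, Matrix.diag_apply, Matrix.mul_apply, Fin.sum_univ_three] at h1 h2
  ext j k
  simp only [Matrix.mul_apply, Fin.sum_univ_three, Matrix.det_fin_three, Matrix.smul_apply,
    smul_eq_mul]
  fin_cases j <;> fin_cases k <;> simp
  -- In each case the multiplier of `h1` is the entry of `A²`, and the entry of `A` multiplies the
  -- vanishing second coefficient.
  · linear_combination (A 0 0 * A 0 0 + A 0 1 * A 1 0 + A 0 2 * A 2 0) * h1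
      - A 0 0 * ((A 0 0 + A 1 1 + A 2 2) * h1 - h2) / 2
  · linear_combination (A 0 0 * A 0 1 + A 0 1 * A 1 1 + A 0 2 * A 2 1) * h1
      - A 0 1 * ((A 0 0 + A 1 1 + A 2 2) * h1 - h2) / 2
  · linear_combination (A 0 0 * A 0 2 + A 0 1 * A 1 2 + A 0 2 * A 2 2) * h1
      - A 0 2 * ((A 0 0 + A 1 1 + A 2 2) * h1 - h2) / 2
  · linear_combination (A 1 0 * A 0 0 + A 1 1 * A 1 0 + A 1 2 * A 2 0) * h1
      - A 1 0 * ((A 0 0 + A 1 1 + A 2 2) * h1 - h2) / 2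
  · linear_combination (A 1 0 * A 0 1 + A 1 1 * A 1 1 + A 1 2 * A 2 1) * h1
      - A 1 1 * ((A 0 0 + A 1 1 + A 2 2) * h1 - h2) / 2
  · linear_combination (A 1 0 * A 0 2 + A 1 1 * A 1 2 + A 1 2 * A 2 2) * h1
      - A 1 2 * ((A 0 0 + A 1 1 + A 2 2) * h1 - h2) / 2
  · linear_combination (A 2 0 * A 0 0 + A 2 1 * A 1 0 + A 2 2 * A 2 0) * h1
      - A 2 0 * ((A 0 0 + A 1 1 + A 2 2) * h1 - h2) / 2
  · linear_combination (A 2 0 * A 0 1 + A 2 1 * A 1 1 + A 2 2 * A 2 1) * h1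
      - A 2 1 * ((A 0 0 + A 1 1 + A 2 2) * h1 - h2) / 2
  · linear_combination (A 2 0 * A 0 2 + A 2 1 * A 1 2 + A 2 2 * A 2 2) * h1
      - A 2 2 * ((A 0 0 + A 1 1 + A 2 2) * h1 - h2) / 2

/-- The change of frame that turns `A` into its companion matrix, scaled by `e`. -/
def cyclicFrame (e : ℂ) (A : Matrix (Fin 3) (Fin 3) ℂ) : Matrix (Fin 3) (Fin 3) ℂ :=
  Matrix.of fun j k => e⁻¹ ^ (j : ℕ) * (A ^ (j : ℕ)) 0 k

/-- The frame is lower triangular with diagonal `1`, `e⁻¹ A₀₁`, `e⁻² A₀₁ A₁₂`. -/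
theorem det_cyclicFrame (e : ℂ) {A : Matrix (Fin 3) (Fin 3) ℂ} (hA : A 0 2 = 0) :
    (cyclicFrame e A).det = e⁻¹ ^ 3 * A 0 1 ^ 2 * A 1 2 := by
  simp [cyclicFrame, Matrix.det_fin_three, pow_two, Matrix.mul_apply, Fin.sum_univ_three, hA]
  ring

/-- Right multiplication by `A` shifts each row to `e` times the next; the last row returns to a
multiple of the first because `A³` is scalar. -/
theorem cyclicFrame_mul {e : ℂ} (he : e ≠ 0) {A : Matrix (Fin 3) (Fin 3) ℂ} (h1 : A.trace = 0)
    (h2 : (A * A).trace = 0) :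
    cyclicFrame e A * A = !![0, e, 0; 0, 0, e; A.det / e ^ 2, 0, 0] * cyclicFrame e A := by
  have key : ∀ j k, (cyclicFrame e A * A) j k = e⁻¹ ^ (j : ℕ) * (A ^ ((j : ℕ) + 1)) 0 k := by
    intro j k
    rw [pow_succ, Matrix.mul_apply, Matrix.mul_apply, Finset.mul_sum]
    simp only [cyclicFrame, Matrix.of_apply, mul_assoc]
  have h3 : A ^ 3 = A.det • (1 : Matrix (Fin 3) (Fin 3) ℂ) := by
    rw [← pow_three_eq_det h1 h2, pow_succ, pow_two]
  ext j k
  rw [key]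
  fin_cases j
  · simp [cyclicFrame, Matrix.mul_apply, Fin.sum_univ_three, he]
  · simp [cyclicFrame, Matrix.mul_apply, Fin.sum_univ_three]
    field_simp
  · simp [cyclicFrame, Matrix.mul_apply, Fin.sum_univ_three, h3]
    field_simp

theorem differentiable_cyclicFrame {e : ℂ → ℂ} (he : Differentiable ℂ e) (he0 : ∀ x, e x ≠ 0)
    {A : ℂ → Matrix (Fin 3) (Fin 3) ℂ} (hA : ∀ j k, Differentiable ℂ fun x => A x j k)
    (j k : Fin 3) : Differentiable ℂ fun x => cyclicFrame (e x) (A x) j k := by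
  have hp : ∀ (m : ℕ) j k, Differentiable ℂ fun x => (A x ^ m) j k := by
    intro m
    induction m with
    | zero => intro j k; simp
    | succ m ih => simpa only [pow_succ] using differentiable_matrix_mul ih hA
  exact ((he.inv he0).pow _).mul (hp _ _ _)

/-- Row `j` gains `(-z) ^ j` from the power of `A` and `(-1) ^ j` from that of `e`. The remaining `z
^ j` changes the weight `z⁻¹` of row `0` into `z ^ (j - 1)`, the weight of row `j`. -/
theorem cyclicFrame_compat {z e₀ e₁ : ℂ} (hz : z ≠ 0) (he : e₀ = -e₁)
    {A B : Matrix (Fin 3) (Fin 3) ℂ}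
    (h : A * (sumO ![-1, 0, 1]).T z = -z • ((sumO ![-1, 0, 1]).T z * B)) :
    cyclicFrame e₀ A * (sumO ![-1, 0, 1]).T z = (sumO ![-1, 0, 1]).T z * cyclicFrame e₁ B := by
  have hp : ∀ m : ℕ, A ^ m * (sumO ![-1, 0, 1]).T z
      = (-z) ^ m • ((sumO ![-1, 0, 1]).T z * B ^ m) := by
    intro m
    induction m with
    | zero => simp
    | succ m ih =>
      rw [pow_succ, Matrix.mul_assoc, h, Matrix.mul_smul, ← Matrix.mul_assoc, ih,
        Matrix.smul_mul, smul_smul, Matrix.mul_assoc, ← pow_succ, ← pow_succ']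
  ext j k
  have := congrFun (congrFun (hp j) 0) k
  simp only [sumO, Matrix.mul_diagonal, Matrix.diagonal_mul, Matrix.smul_apply,
    smul_eq_mul] at this
  simp only [sumO, Matrix.mul_diagonal, Matrix.diagonal_mul, cyclicFrame, Matrix.of_apply]
  rw [mul_assoc, this, he]
  fin_cases j
  · simp
  · simp [O, inv_neg]
    field_simp
    simp
  · simp [O, inv_neg]
    field_simp

/-- The Higgs field with the cyclic matrix `(0, e, 0; 0, 0, e; det Φ / e², 0, 0)`. -/
def HiggsField.cyclic (hD : D.card = 3) {e : Fin 2 → ℂ → ℂ}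
    (he : e ∈ H0 fun z => -1 * z ^ (0 : ℤ)) (he0 : ∀ i x, e i x ≠ 0) :
    HiggsField D (sumO ![-1, 0, 1]) where
  loc i x := !![0, e i x, 0; 0, 0, e i x; (Φ.loc i x).det / e i x ^ 2, 0, 0]
  holo i j k := by
    have := he.1 i
    have hq : Differentiable ℂ fun x => (Φ.loc i x).det / e i x ^ 2 :=
      (differentiable_matrix_det (Φ.holo i)).div (this.pow 2) fun x => pow_ne_zero 2 (he0 i x)
    fin_cases j <;> fin_cases k <;> simp <;> assumption
  trace_eq_zero i x := by simp [Matrix.trace_fin_three]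
  compat z hz := by
    have h : e 0 z = -e 1 z⁻¹ := by simpa using he.2 z hz
    have hd : (Φ.loc 0 z).det = (-1) ^ 3 * z ^ 3 * (Φ.loc 1 z⁻¹).det :=
      (Φ.det_mem_H0 hD).2 z hz
    have h1 := he0 1 z⁻¹
    rw [K_mul_OD hD hz, hd, h]
    ext j k
    fin_cases j <;> fin_cases k <;>
      simp [sumO, O]
    · field_simp
    · field_simp
    · field_simp

theorem HiggsField.isomorphic_cyclic (hD : D.card = 3) {e : Fin 2 → ℂ → ℂ}
    (he : e ∈ H0 fun z => -1 * z ^ (0 : ℤ)) (he0 : ∀ i x, e i x ≠ 0)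
    (hnil : ∀ i x, point i x ∈ D → IsNilpotent (Φ.loc i x))
    (h01 : ∀ i x, Φ.loc i x 0 1 ≠ 0) (h12 : ∀ i x, Φ.loc i x 1 2 ≠ 0) :
    Φ.Isomorphic (Φ.cyclic hD he he0) := by
  refine ⟨⟨fun i x => cyclicFrame (e i x) (Φ.loc i x),
    fun i => differentiable_cyclicFrame (he.1 i) (he0 i) (Φ.holo i), fun z hz => ?_⟩,
    fun i x => ?_, fun i x => ?_⟩
  · refine cyclicFrame_compat hz ?_ ?_
    · simpa using he.2 z hz
    · rw [Φ.compat z hz, K_mul_OD hD hz]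
  · rw [Matrix.isUnit_iff_isUnit_det, det_cyclicFrame _ (Φ.loc_zero_two hD i x)]
    exact (mul_ne_zero (mul_ne_zero (pow_ne_zero _ (inv_ne_zero (he0 i x)))
      (pow_ne_zero _ (h01 i x))) (h12 i x)).isUnit
  · exact cyclicFrame_mul (he0 i x) (Φ.trace_eq_zero i x) (Φ.trace_sq_eq_zero hD hnil i x)

theorem HiggsField.IsCyclic.det_eq {Φ : HiggsField D (sumO ![-1, 0, 1])} {e Q : Fin 2 → ℂ → ℂ}
    (h : Φ.IsCyclic e Q) (i : Fin 2) (x : ℂ) :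
    (Φ.loc i x).det = divisorEq D i x * Q i x := by
  obtain ⟨q, hq, hQ⟩ := h i x
  rw [← hQ, hq]
  simp [Matrix.det_fin_three]
  ring

/-- On `D` the relation for the corner entry reads `q e² = 0`, and `e` does not vanish, so the
corner has no pole. -/
theorem HiggsField.IsCyclic.residue_eq {Φ : HiggsField D (sumO ![-1, 0, 1])}
    {e Q : Fin 2 → ℂ → ℂ} (h : Φ.IsCyclic e Q) {i : Fin 2} {x : ℂ} (he : e i x ≠ 0)
    (hx : point i x ∈ D) :
    residue D i (Φ.loc i) x =
      !![0, residue D i (e i) x, 0; 0, 0, residue D i (e i) x; 0, 0, 0] := by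
  obtain ⟨q, hq, hQ⟩ := h i x
  rw [(divisorEq_eq_zero_iff D i x).2 hx, zero_mul] at hQ
  have hq0 : q = 0 := (mul_eq_zero.1 hQ).resolve_right (pow_ne_zero 2 he)
  subst hq0
  simp only [residue, hq]
  ext j k
  fin_cases j <;> fin_cases k <;> simp

/-- A cubic differential is determined by its product with the equation of the divisor. -/
theorem H0_cubic_ext (hD : D.card = 3) {Q Q' : H0 (K ^ 3 * OD D ^ 2)}
    (h : ∀ i x, divisorEq D i x * Q.1 i x = divisorEq D i x * Q'.1 i x) : Q = Q' := by
  have hmem : (Q - Q').1 ∈ H0 fun z => -1 * z ^ (0 : ℤ) := by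
    rw [← H0_cubic hD]
    exact (Q - Q').2
  -- The difference has degree 0, so a zero at one point off `D` makes it vanish identically.
  obtain ⟨x, hx⟩ := exists_divisorEq_ne_zero D 0
  by_contra hne
  refine ne_zero_of_mem_H0 hmem (fun h0 => hne (sub_eq_zero.1 (Subtype.ext h0))) 0 x ?_
  exact sub_eq_zero.2 (mul_left_cancel₀ hx (h 0 x))

end Sphere

end

theorem mainTheorem11 (D : Finset (OnePoint ℂ)) (hD : D.card = 3) :
    Module.finrank ℂ (Sphere.H0 (Sphere.K ^ 3 * Sphere.OD D ^ 2)) = 1 ∧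
    Module.finrank ℂ (Sphere.H0 (Sphere.K * Sphere.O (-1) * Sphere.OD D)) = 1 ∧
    ∀ e ∈ Sphere.H0 (Sphere.K * Sphere.O (-1) * Sphere.OD D), e ≠ 0 →
    ∀ (W : Sphere.VBundle 3) (Φ : Sphere.HiggsField D W),
      (∃ f : Sphere.BundleHom W (Sphere.sumO ![-1, 0, 1]), f.IsIso) →
      Φ.StronglyParabolic → Φ.Stable →
      ∃! Q : Sphere.H0 (Sphere.K ^ 3 * Sphere.OD D ^ 2),
        ∃ Ψ : Sphere.HiggsField D (Sphere.sumO ![-1, 0, 1]),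
          Ψ.IsCyclic e Q ∧ Φ.Isomorphic Ψ ∧
          ∀ i x, Sphere.point i x ∈ D →
            Sphere.residue D i (e i) x ≠ 0 ∧
            Sphere.residue D i (Ψ.loc i) x =
              !![0, Sphere.residue D i (e i) x, 0;
                 0, 0, Sphere.residue D i (e i) x;
                 0, 0, 0] := by
  refine ⟨?_, ?_, ?_⟩
  · rw [Sphere.H0_cubic hD]
    exact Sphere.finrank_H0 (by simp)
  · rw [Sphere.H0_one hD]
    exact Sphere.finrank_H0 (by simp)
  · rintro e he hne W Φ ⟨f, hf⟩ hpar hst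
    rw [Sphere.H0_one hD] at he
    have he0 := Sphere.ne_zero_of_mem_H0 he hne
    have hnil : ∀ i x, Sphere.point i x ∈ D → IsNilpotent ((Φ.conj hf).loc i x) :=
      fun i x hx => Φ.isNilpotent_conj hf (hpar.isNilpotent i x hx)
    obtain ⟨Q, hQ, hdet⟩ := (Φ.conj hf).exists_det_eq hD hnil
    have hiso : Φ.Isomorphic ((Φ.conj hf).cyclic hD he he0) :=
      Sphere.HiggsField.Isomorphic.trans ⟨f, hf, Φ.mul_eq_conj_mul hf⟩
        ((Φ.conj hf).isomorphic_cyclic hD he he0 hnil (hst.loc_zero_one_ne_zero hD hf)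
          (hst.loc_one_two_ne_zero hD hf))
    have hcyc : ((Φ.conj hf).cyclic hD he he0).IsCyclic e Q := fun i x =>
      ⟨_, rfl, by rw [div_mul_cancel₀ _ (pow_ne_zero 2 (he0 i x)), hdet]⟩
    refine ⟨⟨Q, hQ⟩, ⟨_, hcyc, hiso, fun i x hx => ⟨?_, hcyc.residue_eq (he0 i x) hx⟩⟩, ?_⟩
    · exact smul_ne_zero (inv_ne_zero (Sphere.deriv_divisorEq_ne_zero D i x hx)) (he0 i x)
    -- Both products with the divisor equation equal `det Φ`.
    · rintro Q' ⟨Ψ, hΨ, hΦΨ, -⟩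
      refine Sphere.H0_cubic_ext hD fun i x => ?_
      rw [← hΨ.det_eq, ← hΦΨ.det_eq, hiso.det_eq, hcyc.det_eq]
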